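/- Let $H$ be a real Hilbert space and let $I,J:H\to\mathbb R$ be two $C^1$ functionals with compact derivative, i.e. the maps $I',J':H\to H$ (the derivatives, identified with elements of $H$ by the Riesz representation) are continuous and send bounded sets to relatively compact sets. Suppose that $2I-J^2$ is bounded on $H$, that $J(0)\neq 0$, and that $\hat x\in H$ satisfies $J(-\hat x)=-J(\hat x)$. Then for every convex set $S\subseteq H\times\mathbb R$ which is dense in $H\times\mathbb R$ and for every real $r$ satisfying $$r>\frac{\|\hat x\|^2+|J(\hat x)|^2-\inf_{x\in H}\left(\|x\|^2+|J(x)|^2\right)+\sup_H(2I-J^2)-\inf_H(2I-J^2)}{2\inf_{x\in H}\sqrt{\|x\|^2+|J(x)|^2}},$$ there exists $(y_0,\mu_0)\in S$ with $\|y_0\|^2+|\mu_0|^2<r^2$ such that the equation $$x+I'(x)+\mu_0J'(x)=y_0$$ has at least three distinct solutions $x\in H$. -/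

import Mathlib

/-- A (possibly nonlinear) compact map between normed spaces: it is continuous and it maps
bounded sets to relatively compact sets. -/
def IsCompactMap {E F : Type*} [NormedAddCommGroup E] [NormedAddCommGroup F] (T : E → F) : Prop :=
  Continuous T ∧ ∀ B : Set E, Bornology.IsBounded B → IsCompact (closure (T '' B))

/-! Put `f x (y, μ) = ‖x‖²/2 + I x + μ J x - ⟪y, x⟫`; its critical points in `x` solve the equation.
It is affine in `(y, μ)`, and weakly lower semicontinuous and coercive in `x`. The linear terms are
odd under `x̂ ↦ -x̂`, so averaging over `±x̂` bounds the infimum over `x` by some `A` independent of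
`(y, μ)`. By Cauchy–Schwarz the supremum over the `r`-ball is `‖x‖²/2 + I x + r √(‖x‖² + J(x)²)`,
which exceeds `A` exactly thanks to the bound on `r`; density of `S` lets the ball be replaced by
its intersection with `S`. Such a minimax gap forces two global minimizers for some parameter
(`exists_two_minimizers_of_minimax_gap`), and a mountain pass argument resting on Ekeland's
principle adds a third critical point (`exists_third_critical_point`). -/

open Set Filter Topology

/-! ### Ekeland's variational principle -/

/-- A weak form of **Ekeland's variational principle**. -/
theorem LowerSemicontinuous.exists_forall_sub_mul_dist_le {X : Type*} [MetricSpace X]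
    [CompleteSpace X] {F : X → ℝ} (hF : LowerSemicontinuous F) (hb : BddBelow (range F))
    {ε : ℝ} (hε : 0 < ε) (x₀ : X) :
    ∃ x, F x ≤ F x₀ ∧ ∀ y, F x - ε * dist x y ≤ F y := by
  obtain ⟨B, hB⟩ := hb
  have hB' : ∀ x, B ≤ F x := fun x => hB ⟨x, rfl⟩
  -- The successor stays in the cone of points below `x` and minimizes `F` there up to `1 / (n +
  -- 1)`.
  have step : ∀ (n : ℕ) (x : X), ∃ y, F y + ε * dist x y ≤ F x ∧
      ∀ z, F z + ε * dist x z ≤ F x → F y ≤ F z + 1 / ((n : ℝ) + 1) := by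
    intro n x
    set T := F '' {z | F z + ε * dist x z ≤ F x} with hT
    have hne : T.Nonempty := ⟨F x, x, by simp, rfl⟩
    have hTb : BddBelow T := ⟨B, by rintro _ ⟨z, -, rfl⟩; exact hB' z⟩
    have hpos : (0 : ℝ) < 1 / ((n : ℝ) + 1) := Nat.one_div_pos_of_nat
    obtain ⟨_, ⟨y, hy, rfl⟩, hlt⟩ := exists_lt_of_csInf_lt hne (lt_add_of_pos_right (sInf T) hpos)
    refine ⟨y, hy, fun z hz => ?_⟩
    have := csInf_le hTb (mem_image_of_mem F hz)
    linarith
  choose next hnext hmin using step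
  let s : ℕ → X := fun n => Nat.rec x₀ next n
  have hs : ∀ n, s (n + 1) = next n (s n) := fun n => rfl
  have hdist : ∀ n k, F (s (n + k)) + ε * dist (s n) (s (n + k)) ≤ F (s n) := by
    intro n k
    induction k with
    | zero => simp
    | succ k ih =>
      have h1 := hnext (n + k) (s (n + k))
      rw [← hs] at h1
      have h2 := mul_le_mul_of_nonneg_left
        (dist_triangle (s n) (s (n + k)) (s (n + k + 1))) hε.le
      rw [← add_assoc]
      linarith
  have hanti : Antitone fun n => F (s n) := antitone_nat_of_succ_le fun n => by
    have h1 := hdist n 1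
    have h2 := mul_nonneg hε.le (dist_nonneg (x := s n) (y := s (n + 1)))
    linarith
  have hbs : BddBelow (range fun n => F (s n)) := ⟨B, by rintro _ ⟨n, rfl⟩; exact hB' _⟩
  have hlim := tendsto_atTop_ciInf hanti hbs
  set L := ⨅ n, F (s n) with hL
  have hL_le : ∀ n, L ≤ F (s n) := fun n => ciInf_le hbs n
  have hcauchy : CauchySeq s := by
    refine cauchySeq_of_le_tendsto_0' (fun n => (F (s n) - L) / ε) (fun n m hnm => ?_) ?_
    · obtain ⟨k, rfl⟩ := Nat.exists_eq_add_of_le hnm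
      rw [le_div_iff₀ hε]
      have h1 := hdist n k
      have h2 := hL_le (n + k)
      linarith
    · have := (hlim.sub_const L).div_const ε
      simpa using this
  obtain ⟨x, hx⟩ := cauchySeq_tendsto_of_complete hcauchy
  have hxs : ∀ n, F x + ε * dist (s n) x ≤ F (s n) := by
    intro n
    have hlsc : LowerSemicontinuous fun y => F y + ε * dist (s n) y :=
      hF.add (Continuous.lowerSemicontinuous (by fun_prop))
    have hcl : IsClosed {y | F y + ε * dist (s n) y ≤ F (s n)} :=
      hlsc.isClosed_preimage (F (s n))
    refine hcl.mem_of_tendsto hx ?_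
    filter_upwards [eventually_ge_atTop n] with m hm
    obtain ⟨k, rfl⟩ := Nat.exists_eq_add_of_le hm
    exact hdist n k
  have hxle : ∀ n, F x ≤ F (s n) := fun n => by
    have h1 := hxs n
    have h2 := mul_nonneg hε.le (dist_nonneg (x := s n) (y := x))
    linarith
  refine ⟨x, hxle 0, fun y => ?_⟩
  by_contra! hy
  -- A violating `y` lies in every cone, so it competed in every selection; this gives `F x ≤ F y`.
  have hyS : ∀ n, F y + ε * dist (s n) y ≤ F (s n) := fun n => by
    have h1 := hxs n
    have h2 := mul_le_mul_of_nonneg_left (dist_triangle (s n) x y) hε.le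
    linarith
  have h1 : ∀ n : ℕ, F x ≤ F y + 1 / ((n : ℝ) + 1) := fun n =>
    (hxle (n + 1)).trans (by rw [hs]; exact hmin n (s n) y (hyS n))
  have h2 : F x ≤ F y + 0 :=
    ge_of_tendsto' (tendsto_one_div_add_atTop_nhds_zero_nat.const_add (F y)) h1
  have h3 := mul_nonneg hε.le (dist_nonneg (x := x) (y := y))
  linarith

/-! ### Deformation of paths and the mountain pass -/

section MountainPass

variable {H : Type*} [NormedAddCommGroup H] [InnerProductSpace ℝ H] [CompleteSpace H]

theorem exists_mem_segment_sub_eq_inner_gradient {Φ : H → ℝ} {G : H → H}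
    (hG : ∀ x, HasGradientAt Φ (G x) x) (x y : H) :
    ∃ z ∈ segment ℝ x y, Φ y - Φ x = inner ℝ (G z) (y - x) := by
  obtain ⟨z, hz, h⟩ := domain_mvt (s := univ) (x := x) (y := y)
    (fun w _ => (hG w).hasFDerivAt.hasFDerivWithinAt) convex_univ (mem_univ _) (mem_univ _)
  exact ⟨z, hz, by simpa using h⟩

/-- Along a compact path, moving in a direction `v` changes `Φ` to first order uniformly. -/
theorem exists_pos_forall_add_smul_le {Φ : H → ℝ} {G : H → H}
    (hG : ∀ x, HasGradientAt Φ (G x) x) (hGc : Continuous G) (γ v : C(unitInterval, H))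
    (hv : ∀ t, ‖v t‖ ≤ 1) {ε : ℝ} (hε : 0 < ε) :
    ∃ δ > 0, ∀ s, 0 ≤ s → s ≤ δ → ∀ t,
      Φ (γ t + s • v t) ≤ Φ (γ t) + s * (inner ℝ (G (γ t)) (v t) + ε) := by
  have hcont : Continuous fun p : unitInterval × unitInterval =>
      G (γ p.1 + (p.2 : ℝ) • v p.1) := by fun_prop
  obtain ⟨δ, hδ, hunif⟩ := Metric.uniformContinuous_iff.1
    (CompactSpace.uniformContinuous_of_continuous hcont) ε hε
  refine ⟨min (δ / 2) 1, by positivity, fun s hs0 hsδ t => ?_⟩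
  obtain ⟨z, hz, hmv⟩ := exists_mem_segment_sub_eq_inner_gradient hG (γ t) (γ t + s • v t)
  rw [segment_eq_image'] at hz
  obtain ⟨θ, hθ, rfl⟩ := hz
  simp only [add_sub_cancel_left, smul_smul, real_inner_smul_right] at hmv
  have hs1 : s ≤ 1 := hsδ.trans (min_le_right _ _)
  have hs2 : s ≤ δ / 2 := hsδ.trans (min_le_left _ _)
  have hθs0 : 0 ≤ θ * s := mul_nonneg hθ.1 hs0
  have hθs : θ * s ≤ s := mul_le_of_le_one_left hs0 hθ.2
  have hclose := @hunif (t, ⟨θ * s, hθs0, hθs.trans hs1⟩) (t, 0) (by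
    rw [Prod.dist_eq, dist_self, Subtype.dist_eq, max_lt_iff]
    refine ⟨hδ, ?_⟩
    simp only [Set.Icc.coe_zero, Real.dist_eq, sub_zero, abs_of_nonneg hθs0]
    linarith)
  simp only [Set.Icc.coe_zero, zero_smul, add_zero, dist_eq_norm] at hclose
  have hinner : inner ℝ (G (γ t + (θ * s) • v t) - G (γ t)) (v t) ≤ ε := by
    refine (real_inner_le_norm _ _).trans ?_
    calc _ ≤ ε * 1 := mul_le_mul hclose.le (hv t) (norm_nonneg _) hε.le
      _ = ε := mul_one ε
  rw [inner_sub_left] at hinner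
  have := mul_le_mul_of_nonneg_left hinner hs0
  nlinarith

/-- If every path from `x₁` to `x₂` crosses a level which is strictly above both end points, then
there are almost critical points above that level. -/
theorem exists_almost_critical_of_mountain_pass {Φ : H → ℝ} {G : H → H}
    (hG : ∀ x, HasGradientAt Φ (G x) x) (hGc : Continuous G) {x₁ x₂ : H} {a c : ℝ}
    (h₁ : Φ x₁ < a) (h₂ : Φ x₂ < a) (hac : a < c)
    (hpath : ∀ γ : C(unitInterval, H), γ 0 = x₁ → γ 1 = x₂ → ∃ t, c ≤ Φ (γ t)) :
    ∃ C, ∀ ε > 0, ∃ u, a ≤ Φ u ∧ Φ u ≤ C ∧ ‖G u‖ ≤ ε := by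
  have hΦ : Continuous Φ := continuous_iff_continuousAt.2 fun x => (hG x).continuousAt
  let P : Set C(unitInterval, H) := {γ | γ 0 = x₁ ∧ γ 1 = x₂}
  have hPcl : IsClosed P :=
    (isClosed_eq (by fun_prop) continuous_const).inter (isClosed_eq (by fun_prop) continuous_const)
  have : CompleteSpace P := hPcl.completeSpace_coe
  let Ψ : P → ℝ := fun γ => ⨆ t, Φ (γ.1 t)
  have hbdd : ∀ γ : P, BddAbove (range fun t => Φ (γ.1 t)) := fun γ =>
    (isCompact_range (by fun_prop)).bddAbove
  have hle : ∀ (γ : P) t, Φ (γ.1 t) ≤ Ψ γ := fun γ t => le_ciSup (hbdd γ) t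
  have hΨc : ∀ γ : P, c ≤ Ψ γ := fun γ => by
    obtain ⟨t, ht⟩ := hpath γ.1 γ.2.1 γ.2.2
    exact ht.trans (hle γ t)
  have hlsc : LowerSemicontinuous Ψ :=
    lowerSemicontinuous_ciSup hbdd fun t => Continuous.lowerSemicontinuous (by fun_prop)
  let γ₀ : P := ⟨⟨fun t => AffineMap.lineMap x₁ x₂ (t : ℝ), by
    simp only [AffineMap.lineMap_apply]; fun_prop⟩, by simp, by simp⟩
  -- The peak of the straight segment is a bound independent of `ε`; coercivity later turns it into
  -- boundedness.
  refine ⟨Ψ γ₀, fun ε hε => ?_⟩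
  obtain ⟨γ, hγ₀, hγ⟩ := hlsc.exists_forall_sub_mul_dist_le
    ⟨c, by rintro _ ⟨γ, rfl⟩; exact hΨc γ⟩ (ε := ε / 2) (by positivity) γ₀
  by_contra! hcon
  have hbig : ∀ t, a ≤ Φ (γ.1 t) → ε < ‖G (γ.1 t)‖ := fun t ht =>
    hcon _ ht ((hle γ t).trans hγ₀)
  obtain ⟨b, hab, hbc⟩ := exists_between hac
  -- The cut-off freezes the path below `a`, hence its ends, and is full above `b`. Between them no
  -- descent is needed, as `b` is well below the peak.
  let χ : unitInterval → ℝ := fun t => max 0 (min 1 ((Φ (γ.1 t) - a) / (b - a)))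
  have hχ0 : ∀ t, 0 ≤ χ t := fun t => le_max_left _ _
  have hχ1 : ∀ t, χ t ≤ 1 := fun t => max_le zero_le_one (min_le_left _ _)
  have hχa : ∀ t, Φ (γ.1 t) < a → χ t = 0 := fun t ht => by
    refine max_eq_left ((min_le_right _ _).trans ?_)
    exact div_nonpos_of_nonpos_of_nonneg (by linarith) (by linarith)
  have hχb : ∀ t, b ≤ Φ (γ.1 t) → χ t = 1 := fun t ht => by
    have : 1 ≤ (Φ (γ.1 t) - a) / (b - a) := by
      rw [one_le_div (by linarith)]; linarith
    simp only [χ, min_eq_left this]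
    norm_num
  have hmax : ∀ t, 0 < max ‖G (γ.1 t)‖ ε := fun t => hε.trans_le (le_max_right _ _)
  -- Dividing by the maximum with `ε` keeps the field continuous at zeros of `G`, and still
  -- normalizes it where `‖G‖ > ε`.
  let v : C(unitInterval, H) :=
    ⟨fun t => -((χ t / max ‖G (γ.1 t)‖ ε) • G (γ.1 t)), by
      have : ∀ t, max ‖G (γ.1 t)‖ ε ≠ 0 := fun t => (hmax t).ne'
      fun_prop (disch := assumption)⟩
  have hvn : ∀ t, ‖v t‖ ≤ 1 := fun t => by
    have : ‖v t‖ = χ t / max ‖G (γ.1 t)‖ ε * ‖G (γ.1 t)‖ := by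
      simp only [v, ContinuousMap.coe_mk, norm_neg, norm_smul, Real.norm_eq_abs,
        abs_of_nonneg (div_nonneg (hχ0 t) (hmax t).le)]
    rw [this, div_mul_eq_mul_div, div_le_one (hmax t)]
    calc _ ≤ 1 * ‖G (γ.1 t)‖ := mul_le_mul_of_nonneg_right (hχ1 t) (norm_nonneg _)
      _ ≤ _ := by rw [one_mul]; exact le_max_left _ _
  have hvG : ∀ t, inner ℝ (G (γ.1 t)) (v t) = -(χ t / max ‖G (γ.1 t)‖ ε * ‖G (γ.1 t)‖ ^ 2) :=
    fun t => by
      simp only [v, ContinuousMap.coe_mk, inner_neg_right, real_inner_smul_right,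
        real_inner_self_eq_norm_sq]
  obtain ⟨δ, hδ, hdesc⟩ := exists_pos_forall_add_smul_le hG hGc γ.1 v hvn
    (ε := ε / 4) (by positivity)
  obtain ⟨s, hs0, hsδ, hsc⟩ : ∃ s > 0, s ≤ δ ∧ b + s * ε ≤ c := by
    refine ⟨min δ ((c - b) / ε), lt_min hδ (div_pos (by linarith) hε), min_le_left _ _, ?_⟩
    have := mul_le_mul_of_nonneg_right (min_le_right δ ((c - b) / ε)) hε.le
    rw [div_mul_cancel₀ _ hε.ne'] at this
    linarith
  have hend : ∀ t, Φ (γ.1 t) < a → (γ.1 + s • v) t = γ.1 t := fun t ht => by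
    simp [v, hχa t ht]
  let η : P := ⟨γ.1 + s • v,
    by rw [hend 0 (by rw [γ.2.1]; exact h₁), γ.2.1],
    by rw [hend 1 (by rw [γ.2.2]; exact h₂), γ.2.2]⟩
  have hdist : dist γ η ≤ s := by
    rw [Subtype.dist_eq, ContinuousMap.dist_le hs0.le]
    intro t
    simp only [η, dist_eq_norm, ContinuousMap.add_apply, ContinuousMap.smul_apply, sub_add_cancel_left,
      norm_neg, norm_smul, Real.norm_eq_abs, abs_of_pos hs0]
    exact mul_le_of_le_one_right hs0.le (hvn t)
  -- The peak drops by `3/4 * ε * s`, while Ekeland with slope `ε / 2` permits at most `ε / 2 * s`.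
  have hΨη : Ψ η ≤ Ψ γ - s * (3 / 4 * ε) := by
    refine ciSup_le fun t => ?_
    have h := hdesc s hs0.le hsδ t
    change Φ (γ.1 t + s • v t) ≤ _
    refine h.trans ?_
    rw [hvG t]
    by_cases hb : b ≤ Φ (γ.1 t)
    · have hε' := hbig t (hab.le.trans hb)
      rw [hχb t hb, max_eq_left hε'.le, sq, ← mul_assoc,
        one_div_mul_cancel (hε.trans hε').ne', one_mul]
      have := hle γ t
      nlinarith
    · have h1 : 0 ≤ χ t / max ‖G (γ.1 t)‖ ε * ‖G (γ.1 t)‖ ^ 2 :=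
        mul_nonneg (div_nonneg (hχ0 t) (hmax t).le) (sq_nonneg _)
      have h2 := hΨc γ
      nlinarith
  have h1 := hγ η
  have h2 := mul_le_mul_of_nonneg_left hdist (by positivity : (0 : ℝ) ≤ ε / 2)
  nlinarith

end MountainPass

/-! ### Weak limits and weak compactness of sublevel sets -/

section WeakLimits

variable {H : Type*} [NormedAddCommGroup H] [InnerProductSpace ℝ H] [CompleteSpace H]

/-- Bounded ultrafilters on a Hilbert space converge weakly. -/
theorem Ultrafilter.exists_weak_limit_of_norm_le (U : Ultrafilter H) {R : ℝ}
    (hU : ∀ᶠ u in (U : Filter H), ‖u‖ ≤ R) :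
    ∃ x : H, ∀ v, Tendsto (fun u => inner ℝ v u) U (𝓝 (inner ℝ v x)) := by
  let D : H → WeakDual ℝ H := fun u => StrongDual.toWeakDual (InnerProductSpace.toDual ℝ H u)
  obtain ⟨x', -, hx'⟩ := (WeakDual.isCompact_closedBall (𝕜 := ℝ) (E := H) 0 R).ultrafilter_le_nhds'
    (U.map D) (by
      refine hU.mono fun u hu => ?_
      simpa [D] using hu)
  refine ⟨(InnerProductSpace.toDual ℝ H).symm (WeakDual.toStrongDual x'), fun v => ?_⟩
  have h1 : Tendsto D U (𝓝 x') := hx'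
  have h2 := ((WeakDual.eval_continuous v).tendsto x').comp h1
  rw [real_inner_comm, InnerProductSpace.toDual_symm_apply]
  refine h2.congr fun u => ?_
  simp [D, real_inner_comm]

/-- A functional with compact gradient is weakly continuous on bounded sets. -/
theorem IsCompactMap.tendsto_of_weak_limit {K : H → ℝ} {k : H → H}
    (hK : ∀ x, HasGradientAt K (k x) x) (hk : IsCompactMap k) {ι : Type*} {U : Ultrafilter ι}
    {s : ι → H} {R : ℝ} (hR : ∀ᶠ i in (U : Filter ι), ‖s i‖ ≤ R) {x : H}
    (hx : ∀ v, Tendsto (fun i => inner ℝ v (s i)) U (𝓝 (inner ℝ v x))) :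
    Tendsto (fun i => K (s i)) U (𝓝 (K x)) := by
  choose z hz hmv using fun u => exists_mem_segment_sub_eq_inner_gradient hK x u
  have hzR : ∀ᶠ i in (U : Filter ι), z (s i) ∈ Metric.closedBall (0 : H) (max R ‖x‖) := by
    filter_upwards [hR] with i hi
    refine (convex_closedBall (0 : H) _).segment_subset ?_ ?_ (hz (s i))
    · simp
    · simp [hi]
  -- Compactness makes the mean-value gradients converge strongly, so they can be paired with the
  -- weakly convergent increments.
  obtain ⟨w, -, hw⟩ := (hk.2 _ Metric.isBounded_closedBall).ultrafilter_le_nhds'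
    (U.map fun i => k (z (s i))) (hzR.mono fun i hi => subset_closure (mem_image_of_mem k hi))
  have hw' : Tendsto (fun i => k (z (s i))) U (𝓝 w) := hw
  have h1 : Tendsto (fun i => ‖k (z (s i)) - w‖ * (R + ‖x‖)) U (𝓝 0) := by
    simpa using (tendsto_iff_norm_sub_tendsto_zero.1 hw').mul_const (R + ‖x‖)
  have h2 : Tendsto (fun i => inner ℝ (k (z (s i)) - w) (s i - x)) U (𝓝 0) := by
    refine squeeze_zero_norm' ?_ h1
    filter_upwards [hR] with i hi
    refine (norm_inner_le_norm _ _).trans ?_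
    exact mul_le_mul_of_nonneg_left ((norm_sub_le _ _).trans (by linarith)) (norm_nonneg _)
  have h3 := ((h2.add (hx w)).add_const (K x - inner ℝ w x))
  refine (h3.congr fun i => ?_).trans (by simp)
  have := hmv (s i)
  simp only [inner_sub_left, inner_sub_right] at this ⊢
  linarith

/-- The functional `‖x‖² / 2 + K x` is weakly lower semicontinuous on bounded sets. -/
theorem half_norm_sq_add_le_of_weak_limit {K : H → ℝ} {k : H → H}
    (hK : ∀ x, HasGradientAt K (k x) x) (hk : IsCompactMap k) {ι : Type*} {U : Ultrafilter ι}
    {s : ι → H} {R c : ℝ} (hR : ∀ᶠ i in (U : Filter ι), ‖s i‖ ≤ R) {x : H}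
    (hx : ∀ v, Tendsto (fun i => inner ℝ v (s i)) U (𝓝 (inner ℝ v x)))
    (hc : ∀ᶠ i in (U : Filter ι), ‖s i‖ ^ 2 / 2 + K (s i) ≤ c) :
    ‖x‖ ^ 2 / 2 + K x ≤ c := by
  have h1 := ((hx x).sub_const (‖x‖ ^ 2 / 2)).add (hk.tendsto_of_weak_limit hK hR hx)
  have h2 := le_of_tendsto h1 (b := c) (by
    filter_upwards [hc] with i hi
    have h := norm_sub_sq_real x (s i)
    have h' := sq_nonneg ‖x - s i‖
    linarith)
  rw [real_inner_self_eq_norm_sq] at h2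
  linarith

/-- Sublevel sets of a coercive functional `‖x‖² / 2 + K x` are weakly compact. -/
theorem isCompact_weakSpace_sublevel {K : H → ℝ} {k : H → H}
    (hK : ∀ x, HasGradientAt K (k x) x) (hk : IsCompactMap k) {c : ℝ}
    (hb : Bornology.IsBounded {x : H | ‖x‖ ^ 2 / 2 + K x ≤ c}) :
    IsCompact {x : WeakSpace ℝ H | ‖(toWeakSpace ℝ H).symm x‖ ^ 2 / 2
      + K ((toWeakSpace ℝ H).symm x) ≤ c} := by
  obtain ⟨R, hR⟩ := hb.exists_norm_le
  rw [isCompact_iff_ultrafilter_le_nhds']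
  intro U hU
  have hU' : ∀ᶠ x in (U : Filter (WeakSpace ℝ H)), ‖(toWeakSpace ℝ H).symm x‖ ^ 2 / 2
      + K ((toWeakSpace ℝ H).symm x) ≤ c := hU
  have hUR : ∀ᶠ u in (U : Filter (WeakSpace ℝ H)), ‖(toWeakSpace ℝ H).symm u‖ ≤ R :=
    hU'.mono fun u hu => hR _ hu
  obtain ⟨x, hx⟩ := (U.map (toWeakSpace ℝ H).symm).exists_weak_limit_of_norm_le hUR
  have hx' : ∀ v, Tendsto (fun i => inner ℝ v ((toWeakSpace ℝ H).symm i)) U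
    (𝓝 (inner ℝ v x)) := hx
  refine ⟨toWeakSpace ℝ H x, ?_, ?_⟩
  · simpa using half_norm_sq_add_le_of_weak_limit hK hk hUR hx' hU'
  · have hinj : Function.Injective (topDualPairing ℝ H).flip := by
      intro u v huv
      refine ext_inner_left ℝ fun w => ?_
      exact congrArg (fun l : StrongDual ℝ H →ₗ[ℝ] ℝ => l (InnerProductSpace.toDual ℝ H w)) huv
    have : Tendsto id (U : Filter (WeakSpace ℝ H)) (𝓝 (toWeakSpace ℝ H x)) := by
      refine (WeakBilin.tendsto_iff_forall_eval_tendsto _ hinj).2 fun l => ?_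
      have h := hx' ((InnerProductSpace.toDual ℝ H).symm l)
      simp only [InnerProductSpace.toDual_symm_apply] at h
      exact h
    exact this

end WeakLimits

/-! ### From two minimizers to three critical points -/

section ThreeCriticalPoints

variable {H : Type*} [NormedAddCommGroup H] [InnerProductSpace ℝ H] [CompleteSpace H]

theorem HasGradientAt.half_norm_sq_add {K : H → ℝ} {k x : H} (hK : HasGradientAt K k x) :
    HasGradientAt (fun x => ‖x‖ ^ 2 / 2 + K x) (x + k) x := by
  rw [hasGradientAt_iff_hasFDerivAt] at hK ⊢
  have h := ((hasStrictFDerivAt_norm_sq x).hasFDerivAt.mul_const (2⁻¹ : ℝ)).add hK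
  refine h.congr_fderiv ?_
  ext v
  simp

theorem HasGradientAt.eq_zero_of_forall_le {Φ : H → ℝ} {g x : H} (h : HasGradientAt Φ g x)
    (hmin : ∀ y, Φ x ≤ Φ y) : g = 0 := by
  have h1 : IsLocalMin Φ x := Eventually.of_forall hmin
  simpa using h1.hasFDerivAt_eq_zero h.hasFDerivAt

/-- Bounded sequences minimizing `‖x‖² / 2 + K x` have a strong cluster point. -/
theorem exists_tendsto_of_tendsto_min {K : H → ℝ} {k : H → H}
    (hK : ∀ x, HasGradientAt K (k x) x) (hk : IsCompactMap k) {ι : Type*} {U : Ultrafilter ι}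
    {s : ι → H} {R m : ℝ} (hR : ∀ᶠ i in (U : Filter ι), ‖s i‖ ≤ R)
    (hm : ∀ x, m ≤ ‖x‖ ^ 2 / 2 + K x)
    (hs : Tendsto (fun i => ‖s i‖ ^ 2 / 2 + K (s i)) U (𝓝 m)) :
    ∃ x, Tendsto s U (𝓝 x) := by
  obtain ⟨x, hx⟩ := (U.map s).exists_weak_limit_of_norm_le hR
  have hx' : ∀ v, Tendsto (fun i => inner ℝ v (s i)) U (𝓝 (inner ℝ v x)) := hx
  refine ⟨x, ?_⟩
  have h1 := ((((hs.sub (hk.tendsto_of_weak_limit hK hR hx')).const_mul 2).sub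
    ((hx' x).const_mul 2)).add_const (‖x‖ ^ 2))
  have h2 : Tendsto (fun i => ‖s i - x‖ ^ 2) U
      (𝓝 (2 * (m - K x) - 2 * inner ℝ x x + ‖x‖ ^ 2)) := by
    refine h1.congr fun i => ?_
    rw [norm_sub_sq_real, real_inner_comm]
    ring
  -- Minimality of `m` at the weak limit makes the limiting squared distance nonpositive.
  have h3 : 2 * (m - K x) - 2 * inner ℝ x x + ‖x‖ ^ 2 = 0 := by
    refine le_antisymm ?_ (ge_of_tendsto' h2 fun i => sq_nonneg _)
    rw [real_inner_self_eq_norm_sq]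
    linarith [hm x]
  rw [h3] at h2
  rw [tendsto_iff_norm_sub_tendsto_zero]
  simpa [Real.sqrt_sq] using h2.sqrt

/-- Two distinct global minimizers of a coercive functional `‖x‖² / 2 + K x`, with `K` of compact
gradient `k`, force a third critical point. -/
theorem exists_third_critical_point {K : H → ℝ} {k : H → H}
    (hK : ∀ x, HasGradientAt K (k x) x) (hk : IsCompactMap k)
    (hb : ∀ c, Bornology.IsBounded {x : H | ‖x‖ ^ 2 / 2 + K x ≤ c}) {x₁ x₂ : H} (hne : x₁ ≠ x₂)
    (h₁ : ∀ y, ‖x₁‖ ^ 2 / 2 + K x₁ ≤ ‖y‖ ^ 2 / 2 + K y)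
    (h₂ : ∀ y, ‖x₂‖ ^ 2 / 2 + K x₂ ≤ ‖y‖ ^ 2 / 2 + K y) :
    ∃ x, x ≠ x₁ ∧ x ≠ x₂ ∧ x + k x = 0 := by
  set Φ : H → ℝ := fun x => ‖x‖ ^ 2 / 2 + K x with hΦdef
  have hG : ∀ x, HasGradientAt Φ (x + k x) x := fun x => (hK x).half_norm_sq_add
  have hΦ : Continuous Φ := continuous_iff_continuousAt.2 fun x => (hG x).continuousAt
  have hkc : Continuous k := hk.1
  have h₁₂ : Φ x₂ = Φ x₁ := le_antisymm (h₂ x₁) (h₁ x₂)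
  set ρ := ‖x₂ - x₁‖ / 2 with hρdef
  have hρ : 0 < ρ := half_pos (norm_pos_iff.2 (sub_ne_zero.2 hne.symm))
  have hsphere : ∀ x, ‖x - x₁‖ = ρ → x ≠ x₁ ∧ x ≠ x₂ := by
    rintro x hx
    constructor
    · rintro rfl; simp at hx; linarith
    · rintro rfl; linarith
  -- Either the sphere separating the minimizers is a genuine barrier, giving a mountain pass, or a
  -- minimizing sequence on it converges strongly to a third minimizer.
  by_cases hc : ∃ c, Φ x₁ < c ∧ ∀ x, ‖x - x₁‖ = ρ → c ≤ Φ x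
  · obtain ⟨c, hc₁, hc⟩ := hc
    obtain ⟨a, ha, hac⟩ := exists_between hc₁
    obtain ⟨C, hC⟩ := exists_almost_critical_of_mountain_pass hG (by fun_prop) ha (h₁₂ ▸ ha) hac
      (fun γ h0 h1 => by
        have hcont : Continuous fun t => ‖γ t - x₁‖ := by fun_prop
        obtain ⟨t, ht⟩ := mem_range_of_exists_le_of_exists_ge hcont (c := ρ)
          ⟨0, by simp [h0, hρ.le]⟩ ⟨1, by rw [h1]; linarith⟩
        exact ⟨t, hc _ ht⟩)
    choose u hua huC huG using fun n : ℕ => hC (1 / ((n : ℝ) + 1)) Nat.one_div_pos_of_nat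
    let U : Ultrafilter ℕ := hyperfilter ℕ
    have hU : (U : Filter ℕ) ≤ atTop := Nat.hyperfilter_le_atTop
    obtain ⟨w, -, hw⟩ := (hk.2 _ (hb C)).ultrafilter_le_nhds' (U.map fun n => k (u n))
      (Ultrafilter.mem_map.2
        (univ_mem' fun n => subset_closure (mem_image_of_mem k (huC n))))
    have hw' : Tendsto (fun n => k (u n)) U (𝓝 w) := hw
    have hg : Tendsto (fun n => u n + k (u n)) U (𝓝 0) :=
      squeeze_zero_norm huG (tendsto_one_div_add_atTop_nhds_zero_nat.mono_left hU)
    have hu : Tendsto u U (𝓝 (-w)) := by simpa using hg.sub hw'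
    refine ⟨-w, ?_, ?_, ?_⟩
    · rintro h
      have := ge_of_tendsto' ((hΦ.tendsto _).comp hu) hua
      rw [h] at this; linarith
    · rintro h
      have := ge_of_tendsto' ((hΦ.tendsto _).comp hu) hua
      rw [h] at this; linarith
    · exact tendsto_nhds_unique (((continuous_id.add hkc).tendsto _).comp hu) hg
  · push Not at hc
    choose u hu hlt using fun n : ℕ =>
      hc (Φ x₁ + 1 / ((n : ℝ) + 1)) (lt_add_of_pos_right _ Nat.one_div_pos_of_nat)
    let U : Ultrafilter ℕ := hyperfilter ℕ
    have hU : (U : Filter ℕ) ≤ atTop := Nat.hyperfilter_le_atTop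
    have hlim : Tendsto (fun n => Φ (u n)) U (𝓝 (Φ x₁)) := by
      refine tendsto_of_tendsto_of_tendsto_of_le_of_le tendsto_const_nhds ?_
        (fun n => h₁ (u n)) (fun n => (hlt n).le)
      simpa using (tendsto_one_div_add_atTop_nhds_zero_nat.mono_left hU).const_add (Φ x₁)
    obtain ⟨x, hx⟩ := exists_tendsto_of_tendsto_min hK hk (R := ‖x₁‖ + ρ)
      (Eventually.of_forall fun n => by
        have := norm_add_le x₁ (u n - x₁)
        rw [hu, add_sub_cancel] at this
        exact this) h₁ hlim
    have hxρ : ‖x - x₁‖ = ρ :=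
      tendsto_nhds_unique (hx.sub_const x₁).norm (by simp [hu])
    have hxm : Φ x = Φ x₁ := tendsto_nhds_unique ((hΦ.tendsto x).comp hx) hlim
    exact ⟨x, (hsphere x hxρ).1, (hsphere x hxρ).2,
      (hG x).eq_zero_of_forall_le fun y => hxm.le.trans (h₁ y)⟩

end ThreeCriticalPoints

/-! ### Minimax gap and non-uniqueness of minimizers -/

/-- If `f x` is concave and continuous, the functions `f · z` have compact sublevel sets, and the
infima over `x` are at most `A` for all `z ∈ S` while `sup_{z ∈ S} f x z > A` for all `x`, then
some `f · z` with `z ∈ S` has two global minimizers. -/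
theorem exists_two_minimizers_of_minimax_gap {X E : Type*} [TopologicalSpace X] [T2Space X]
    [NormedAddCommGroup E] [NormedSpace ℝ E] {f : X → E → ℝ} {S : Set E} (hS : Convex ℝ S)
    (hcomp : ∀ z ∈ S, ∀ c, IsCompact {x | f x z ≤ c}) (hconc : ∀ x, ConcaveOn ℝ S (f x))
    (hcont : ∀ x, Continuous (f x)) {A : ℝ} (hlow : ∀ z ∈ S, ∃ x, f x z ≤ A)
    (hup : ∀ x, ∃ z ∈ S, A < f x z) (hne : Nonempty X) :
    ∃ z ∈ S, ∃ x₁ x₂, x₁ ≠ x₂ ∧ (∀ x, f x₁ z ≤ f x z) ∧ (∀ x, f x₂ z ≤ f x z) := by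
  obtain ⟨z₀, hz₀, -⟩ := hup hne.some
  have hmin : ∀ z ∈ S, ∃ x, ∀ y, f x z ≤ f y z := by
    intro z hz
    obtain ⟨x₀, -⟩ := hlow z hz
    have hlsc : LowerSemicontinuous fun x => f x z :=
      lowerSemicontinuous_iff_isClosed_preimage.2 fun c => (hcomp z hz c).isClosed
    obtain ⟨x, hx, hxm⟩ := (hlsc.lowerSemicontinuousOn _).exists_isMinOn
      (⟨x₀, le_refl (f x₀ z)⟩ : {x | f x z ≤ f x₀ z}.Nonempty) (hcomp z hz _)
    refine ⟨x, fun y => ?_⟩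
    by_cases hy : f y z ≤ f x₀ z
    · exact hxm hy
    · exact le_trans hx (not_le.1 hy).le
  -- By compactness finitely many parameters already witness the gap, so the maximization of the
  -- minimal value can be done on a compact convex hull.
  obtain ⟨F, hF⟩ := (hcomp z₀ hz₀ A).elim_finite_subfamily_closed
    (fun z : S => {x | f x z ≤ A}) (fun z => (hcomp z z.2 A).isClosed) (by
      ext x
      obtain ⟨z, hz, hlt⟩ := hup x
      simp only [mem_inter_iff, mem_iInter, mem_empty_iff_false, iff_false, not_and]
      exact fun _ h => (h ⟨z, hz⟩).not_gt hlt)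
  let T : Set E := insert z₀ (Subtype.val '' (F : Set S))
  have hTS : T ⊆ S := by
    rintro z (rfl | ⟨w, -, rfl⟩)
    · exact hz₀
    · exact w.2
  have hTempty : ∀ x, ∃ z ∈ T, A < f x z := by
    intro x
    by_contra! h
    have : x ∈ ({x | f x z₀ ≤ A} ∩ ⋂ i ∈ F, {x | f x (i : S) ≤ A} : Set X) :=
      ⟨h z₀ (mem_insert _ _), mem_iInter₂.2 fun i hi =>
        h i (mem_insert_of_mem _ (mem_image_of_mem _ hi))⟩
    rw [hF] at this
    exact this
  have hTfin : T.Finite := (F.finite_toSet.image _).insert _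
  let Q : Set E := convexHull ℝ T
  have hTQ : T ⊆ Q := subset_convexHull ℝ T
  have hQS : Q ⊆ S := convexHull_min hTS hS
  choose! ξ hξ using hmin
  have husc : UpperSemicontinuousOn (fun z => f (ξ z) z) Q := by
    intro z hz c hc
    filter_upwards [((hcont (ξ z)).continuousAt.eventually_lt_const hc).filter_mono
      nhdsWithin_le_nhds, self_mem_nhdsWithin] with w hw hwQ
    exact (hξ w (hQS hwQ) (ξ z)).trans_lt hw
  obtain ⟨z, hzQ, hzmax⟩ := husc.exists_isMaxOn ⟨z₀, hTQ (mem_insert _ _)⟩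
    (hTfin.isCompact_convexHull ℝ)
  have hzS := hQS hzQ
  set M := f (ξ z) z with hM
  have hMA : M ≤ A := by
    obtain ⟨x, hx⟩ := hlow z hzS
    exact (hξ z hzS x).trans hx
  -- Minimizers at parameters slightly off the maximizer `z` towards `y` have value at most `M` at
  -- `y` and nearly `M` at `z`; compactness removes the error.
  have key : ∀ y ∈ T, ∃ x, f x y ≤ M ∧ f x z ≤ M := by
    intro y hy
    have hyQ := hTQ hy
    have hyS := hTS hy
    let D : {ε : ℝ // 0 < ε} → Set X := fun ε => {x | f x y ≤ M} ∩ {x | f x z ≤ M + ε}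
    have hD : (⋂ ε, D ε).Nonempty := by
      have : Nonempty {ε : ℝ // 0 < ε} := ⟨⟨1, one_pos⟩⟩
      refine IsCompact.nonempty_iInter_of_directed_nonempty_isCompact_isClosed D ?_ ?_
        (fun ε => (hcomp y hyS M).inter (hcomp z hzS _))
        (fun ε => (hcomp y hyS M).isClosed.inter (hcomp z hzS _).isClosed)
      · refine directed_of_isDirected_ge ?_
        intro ε₁ ε₂ h x hx
        exact ⟨hx.1, le_trans (b := M + ε₁) hx.2 (add_le_add_right (Subtype.coe_le_coe.2 h) M)⟩
      · rintro ⟨ε, hε⟩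
        set B := f (ξ y) y with hB
        obtain ⟨t, ht0, ht1, htε⟩ : ∃ t : ℝ, 0 < t ∧ t < 1 ∧ t * (M - B) ≤ (1 - t) * ε := by
          have hlim : Tendsto (fun t : ℝ => (1 - t) * ε - t * (M - B)) (𝓝[>] 0)
              (𝓝 ((1 - 0) * ε - 0 * (M - B))) :=
            (Continuous.tendsto (by fun_prop) (0 : ℝ)).mono_left nhdsWithin_le_nhds
          obtain ⟨t, ht, ht', ht''⟩ := ((hlim.eventually_const_lt
            (by simpa using hε : (0 : ℝ) < _)).and (((eventually_lt_nhds one_pos).filter_mono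
              nhdsWithin_le_nhds).and self_mem_nhdsWithin)).exists
          exact ⟨t, ht'', ht', by linarith⟩
        let w := (1 - t) • z + t • y
        have hwQ : w ∈ Q := convex_convexHull ℝ T hzQ hyQ (by linarith) ht0.le (by ring)
        have hwM : f (ξ w) w ≤ M := hzmax hwQ
        have hcc := (hconc (ξ w)).2 hzS hyS (sub_nonneg.2 ht1.le) ht0.le (by ring)
        simp only [smul_eq_mul] at hcc
        have hcc' : (1 - t) * f (ξ w) z + t * f (ξ w) y ≤ M := hcc.trans hwM
        have h1 : M ≤ f (ξ w) z := hξ z hzS _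
        have h2 : B ≤ f (ξ w) y := hξ y hyS _
        refine ⟨ξ w, ?_, ?_⟩
        · have h3 := mul_le_mul_of_nonneg_left h1 (sub_nonneg.2 ht1.le)
          exact le_of_mul_le_mul_left (by linarith) ht0
        · have h3 := mul_le_mul_of_nonneg_left h2 ht0.le
          exact le_of_mul_le_mul_left (by linarith) (sub_pos.2 ht1)
    obtain ⟨x, hx⟩ := hD
    rw [mem_iInter] at hx
    exact ⟨x, (hx ⟨1, one_pos⟩).1, le_of_forall_pos_le_add fun ε hε => (hx ⟨ε, hε⟩).2⟩
  -- The minimizer `ξ z` has value above `A ≥ M` at this `y`, so the point from `key` is a different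
  -- minimizer.
  obtain ⟨y, hyT, hy⟩ := hTempty (ξ z)
  obtain ⟨x, hxy, hxz⟩ := key y hyT
  refine ⟨z, hzS, ξ z, x, ?_, hξ z hzS, fun x' => hxz.trans (hξ z hzS x')⟩
  rintro h
  rw [h] at hy
  linarith

/-- Near `0` continuity keeps `|J x|` away from zero, and elsewhere `‖x‖` does. This makes the
denominator in the bound on `r` positive. -/
theorem iInf_sqrt_norm_sq_add_sq_pos {H : Type*} [NormedAddCommGroup H] {J : H → ℝ}
    (hJ : ContinuousAt J 0) (hJ0 : J 0 ≠ 0) :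
    0 < ⨅ x : H, Real.sqrt (‖x‖ ^ 2 + |J x| ^ 2) := by
  obtain ⟨η, hη, hball⟩ := Metric.continuousAt_iff.1 hJ (|J 0| / 2) (half_pos (abs_pos.2 hJ0))
  refine (lt_min hη (half_pos (abs_pos.2 hJ0))).trans_le (le_ciInf fun x => ?_)
  by_cases hx : ‖x‖ < η
  · have h1 := hball (x := x) (by simpa using hx)
    rw [dist_comm, Real.dist_eq] at h1
    have h2 := abs_sub_abs_le_abs_sub (J 0) (J x)
    refine (min_le_right _ _).trans ((by linarith : |J 0| / 2 ≤ |J x|).trans ?_)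
    exact Real.le_sqrt_of_sq_le (by linarith [sq_nonneg ‖x‖])
  · refine (min_le_left _ _).trans ((not_lt.1 hx).trans ?_)
    exact Real.le_sqrt_of_sq_le (by linarith [sq_nonneg |J x|])

/-! ### The perturbed functionals and their parameters -/

section Perturbation

variable {H : Type*} [NormedAddCommGroup H] [InnerProductSpace ℝ H]

theorem IsCompactMap.add_smul_sub_const {k l : H → H} (hk : IsCompactMap k) (hl : IsCompactMap l)
    (μ : ℝ) (y : H) : IsCompactMap fun x => k x + μ • l x - y := by
  have hkc := hk.1
  have hlc := hl.1
  refine ⟨by fun_prop, fun B hB => ?_⟩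
  refine IsCompact.closure_of_subset
    (((hk.2 B hB).prod (hl.2 B hB)).image (f := fun p : H × H => p.1 + μ • p.2 - y) (by fun_prop)) ?_
  rintro _ ⟨x, hx, rfl⟩
  exact ⟨(k x, l x), ⟨subset_closure (mem_image_of_mem k hx),
    subset_closure (mem_image_of_mem l hx)⟩, rfl⟩

theorem HasGradientAt.add_mul_sub_inner [CompleteSpace H] {I J : H → ℝ} {k l x : H}
    (hI : HasGradientAt I k x) (hJ : HasGradientAt J l x) (μ : ℝ) (y : H) :
    HasGradientAt (fun x => I x + μ * J x - inner ℝ y x) (k + μ • l - y) x := by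
  rw [hasGradientAt_iff_hasFDerivAt] at hI hJ ⊢
  have h := (hI.add (hJ.const_mul μ)).sub (innerSL ℝ y).hasFDerivAt
  refine h.congr_fderiv ?_
  ext v
  simp

/-- Completing the square, `J²/2 + μ J ≥ -μ²/2`, so only `‖x‖²/2` against a linear term remains. -/
theorem isBounded_sublevel_of_le {I J : H → ℝ} {C : ℝ} (hC : ∀ x, J x ^ 2 - C ≤ 2 * I x)
    (μ : ℝ) (y : H) (c : ℝ) :
    Bornology.IsBounded {x : H | ‖x‖ ^ 2 / 2 + (I x + μ * J x - inner ℝ y x) ≤ c} := by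
  refine isBounded_iff_forall_norm_le.2
    ⟨4 * (c + C / 2 + μ ^ 2 / 2 + ‖y‖ ^ 2) + 1, fun x hx => ?_⟩
  simp only [mem_ofPred_eq] at hx
  have h1 := real_inner_le_norm y x
  have h2 := hC x
  nlinarith [sq_nonneg (J x + μ), sq_nonneg (‖x‖ / 2 - ‖y‖), sq_nonneg (‖x‖ - 1 / 2)]

theorem convex_norm_sq_add_abs_sq_lt (r : ℝ) :
    Convex ℝ {z : H × ℝ | ‖z.1‖ ^ 2 + |z.2| ^ 2 < r ^ 2} := by
  have h1 : ConvexOn ℝ univ fun z : H × ℝ => ‖z.1‖ ^ 2 :=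
    ((convexOn_univ_norm (E := H)).comp_linearMap (LinearMap.fst ℝ H ℝ)).pow
      (fun z _ => norm_nonneg z.1) 2
  have h2 : ConvexOn ℝ univ fun z : H × ℝ => |z.2| ^ 2 :=
    ((convexOn_univ_norm (E := ℝ)).comp_linearMap (LinearMap.snd ℝ H ℝ)).pow
      (fun z _ => norm_nonneg z.2) 2
  simpa using (h1.add h2).convex_lt (r ^ 2)

/-- In every direction of the graph of `J`, a dense set contains points of the ball of radius `r`
almost maximizing the pairing with `(-x, J x)`. -/
theorem Dense.exists_mem_lt_norm_sq_add {J : H → ℝ} {S : Set (H × ℝ)} (hS : Dense S) {r A i : ℝ}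
    (hr : 0 < r) {x : H} (hx : 0 < Real.sqrt (‖x‖ ^ 2 + |J x| ^ 2))
    (h : A < ‖x‖ ^ 2 / 2 + i + r * Real.sqrt (‖x‖ ^ 2 + |J x| ^ 2)) :
    ∃ z ∈ S, ‖z.1‖ ^ 2 + |z.2| ^ 2 < r ^ 2 ∧
      A < ‖x‖ ^ 2 / 2 + (i + z.2 * J x - inner ℝ z.1 x) := by
  set s := Real.sqrt (‖x‖ ^ 2 + |J x| ^ 2) with hs
  have hsq : s ^ 2 = ‖x‖ ^ 2 + |J x| ^ 2 := Real.sq_sqrt (by positivity)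
  obtain ⟨ρ, hρ, hρr⟩ : ∃ ρ : ℝ, max ((A - ‖x‖ ^ 2 / 2 - i) / s) 0 < ρ ∧ ρ < r :=
    _root_.exists_between (max_lt (by rw [div_lt_iff₀ hx]; linarith) hr)
  have hρ0 : 0 < ρ := (le_max_right _ _).trans_lt hρ
  have hρA : A - ‖x‖ ^ 2 / 2 - i < ρ * s := (div_lt_iff₀ hx).1 ((le_max_left _ _).trans_lt hρ)
  have hopen : IsOpen {z : H × ℝ | ‖z.1‖ ^ 2 + |z.2| ^ 2 < r ^ 2 ∧
      A < ‖x‖ ^ 2 / 2 + (i + z.2 * J x - inner ℝ z.1 x)} := by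
    have h1 : Continuous fun z : H × ℝ => ‖z.1‖ ^ 2 + |z.2| ^ 2 := by fun_prop
    have h2 : Continuous fun z : H × ℝ => ‖x‖ ^ 2 / 2 + (i + z.2 * J x - inner ℝ z.1 x) := by
      fun_prop
    exact (isOpen_lt h1 continuous_const).inter (isOpen_lt continuous_const h2)
  have hcancel : ρ / s * s = ρ := div_mul_cancel₀ _ hx.ne'
  -- The multiple of `(-x, J x)` of norm `ρ` is the Cauchy–Schwarz extremizer; `ρ < r` leaves an
  -- open condition for density.
  obtain ⟨z, hz, hzS⟩ := hS.inter_open_nonempty _ hopen ⟨(-((ρ / s) • x), ρ / s * J x), by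
    constructor
    · have : ‖-((ρ / s) • x)‖ ^ 2 + |ρ / s * J x| ^ 2 = ρ ^ 2 := by
        rw [norm_neg, norm_smul, Real.norm_eq_abs, abs_mul, mul_pow, mul_pow, ← mul_add, ← hsq,
          sq_abs, ← mul_pow, hcancel]
      simp only [this]
      exact pow_lt_pow_left₀ hρr hρ0.le two_ne_zero
    · have : ρ / s * J x * J x - inner ℝ (-((ρ / s) • x)) x = ρ * s := by
        rw [inner_neg_left, real_inner_smul_left, real_inner_self_eq_norm_sq]
        have h' : J x * J x = |J x| ^ 2 := by rw [sq_abs]; ring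
        calc _ = ρ / s * (‖x‖ ^ 2 + |J x| ^ 2) := by rw [← h']; ring
          _ = ρ / s * s * s := by rw [← hsq]; ring
          _ = ρ * s := by rw [hcancel]
      linarith⟩
  exact ⟨z, hzS, hz.1, hz.2⟩

end Perturbation

/-! ### Assembly of the argument -/

theorem theorem2p8 {H : Type*} [NormedAddCommGroup H] [InnerProductSpace ℝ H] [CompleteSpace H]
    (I J : H → ℝ)
    (hI : ContDiff ℝ 1 I) (hJ : ContDiff ℝ 1 J)
    (hI' : IsCompactMap (fun x => gradient I x)) (hJ' : IsCompactMap (fun x => gradient J x))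
    (hbdd : ∃ C : ℝ, ∀ x : H, |2 * I x - J x ^ 2| ≤ C)
    (hJ0 : J 0 ≠ 0)
    (xhat : H) (hxhat : J (-xhat) = -J xhat)
    (S : Set (H × ℝ)) (hSconv : Convex ℝ S) (hSdense : Dense S)
    (r : ℝ)
    (hr : (‖xhat‖ ^ 2 + |J xhat| ^ 2 - (⨅ x : H, (‖x‖ ^ 2 + |J x| ^ 2))
            + (⨆ x : H, (2 * I x - J x ^ 2)) - (⨅ x : H, (2 * I x - J x ^ 2)))
          / (2 * ⨅ x : H, Real.sqrt (‖x‖ ^ 2 + |J x| ^ 2)) < r) :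
    ∃ y₀ : H, ∃ μ₀ : ℝ, (y₀, μ₀) ∈ S ∧ ‖y₀‖ ^ 2 + |μ₀| ^ 2 < r ^ 2 ∧
      ∃ x₁ x₂ x₃ : H, x₁ ≠ x₂ ∧ x₁ ≠ x₃ ∧ x₂ ≠ x₃ ∧
        x₁ + gradient I x₁ + μ₀ • gradient J x₁ = y₀ ∧
        x₂ + gradient I x₂ + μ₀ • gradient J x₂ = y₀ ∧
        x₃ + gradient I x₃ + μ₀ • gradient J x₃ = y₀ := by
  obtain ⟨C, hC⟩ := hbdd
  have hgradI : ∀ x, HasGradientAt I (gradient I x) x := fun x =>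
    (hI.differentiable one_ne_zero x).hasGradientAt
  have hgradJ : ∀ x, HasGradientAt J (gradient J x) x := fun x =>
    (hJ.differentiable one_ne_zero x).hasGradientAt
  let K : H × ℝ → H → ℝ := fun z x => I x + z.2 * J x - inner ℝ z.1 x
  let k : H × ℝ → H → H := fun z x => gradient I x + z.2 • gradient J x - z.1
  have hK : ∀ z x, HasGradientAt (K z) (k z x) x := fun z x =>
    (hgradI x).add_mul_sub_inner (hgradJ x) z.2 z.1
  have hk : ∀ z, IsCompactMap (k z) := fun z => hI'.add_smul_sub_const hJ' z.2 z.1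
  have hcoer : ∀ z c, Bornology.IsBounded {x : H | ‖x‖ ^ 2 / 2 + K z x ≤ c} := fun z c =>
    isBounded_sublevel_of_le (C := C) (fun x => by linarith [(abs_le.1 (hC x)).1]) z.2 z.1 c
  have hP0 := iInf_sqrt_norm_sq_add_sq_pos hJ.continuous.continuousAt hJ0
  set p := ⨅ x : H, Real.sqrt (‖x‖ ^ 2 + |J x| ^ 2)
  set q := ⨅ x : H, (‖x‖ ^ 2 + |J x| ^ 2)
  set gs := ⨆ x : H, (2 * I x - J x ^ 2)
  set gi := ⨅ x : H, (2 * I x - J x ^ 2)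
  have hp : ∀ x : H, p ≤ Real.sqrt (‖x‖ ^ 2 + |J x| ^ 2) :=
    ciInf_le ⟨0, by rintro _ ⟨x, rfl⟩; exact Real.sqrt_nonneg _⟩
  have hq : ∀ x : H, q ≤ ‖x‖ ^ 2 + |J x| ^ 2 :=
    ciInf_le ⟨0, by rintro _ ⟨x, rfl⟩; positivity⟩
  have hgs : ∀ x : H, 2 * I x - J x ^ 2 ≤ gs :=
    le_ciSup (f := fun x : H => 2 * I x - J x ^ 2)
      ⟨C, by rintro _ ⟨x, rfl⟩; exact (abs_le.1 (hC x)).2⟩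
  have hgi : ∀ x : H, gi ≤ 2 * I x - J x ^ 2 :=
    ciInf_le ⟨-C, by rintro _ ⟨x, rfl⟩; exact (abs_le.1 (hC x)).1⟩
  have hr0 : 0 < r := by
    refine lt_of_le_of_lt (div_nonneg ?_ (by linarith)) hr
    linarith [hq xhat, hgs 0, hgi 0]
  rw [div_lt_iff₀ (by linarith)] at hr
  let f : WeakSpace ℝ H → H × ℝ → ℝ := fun x z =>
    ‖(toWeakSpace ℝ H).symm x‖ ^ 2 / 2 + K z ((toWeakSpace ℝ H).symm x)
  let A := (‖xhat‖ ^ 2 + |J xhat| ^ 2) / 2 + gs / 2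
  obtain ⟨⟨y, μ⟩, ⟨hzS, hzr⟩, x₁, x₂, hne, h₁, h₂⟩ :
      ∃ z ∈ S ∩ {z : H × ℝ | ‖z.1‖ ^ 2 + |z.2| ^ 2 < r ^ 2}, ∃ x₁ x₂ : WeakSpace ℝ H, x₁ ≠ x₂ ∧
        (∀ x, f x₁ z ≤ f x z) ∧ (∀ x, f x₂ z ≤ f x z) := by
    refine exists_two_minimizers_of_minimax_gap (f := f) (A := A)
      (hSconv.inter (convex_norm_sq_add_abs_sq_lt r))
      (fun z _ c => isCompact_weakSpace_sublevel (hK z) (hk z) (hcoer z c)) ?_ ?_ ?_ ?_ ⟨0⟩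
    · refine fun x => ⟨hSconv.inter (convex_norm_sq_add_abs_sq_lt r), ?_⟩
      intro z _ w _ a b _ _ hab
      refine le_of_eq ?_
      obtain rfl : b = 1 - a := by linarith
      simp only [f, K, smul_eq_mul, Prod.fst_add, Prod.smul_fst, Prod.snd_add, Prod.smul_snd,
        inner_add_left, real_inner_smul_left]
      ring
    · intro x
      simp only [f, K]
      fun_prop
    -- If both `x̂` and `-x̂` had value above `A`, adding the two inequalities would cancel the
    -- terms in `z` and contradict the bound `gs`.
    · intro z _
      by_contra! hcon
      have ha := hcon (toWeakSpace ℝ H xhat)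
      have hb := hcon (toWeakSpace ℝ H (-xhat))
      simp only [f, K, A, LinearEquiv.symm_apply_apply, norm_neg, hxhat, inner_neg_right,
        sq_abs] at ha hb
      have hc := hgs xhat
      have hd := hgs (-xhat)
      rw [hxhat, neg_sq] at hd
      linarith
    -- Here `‖u‖²/2 + I u ≥ (q + gi)/2` and the root is at least `p`, so the bound on `r` is what
    -- puts the value above `A`.
    · intro x
      set u : H := (toWeakSpace ℝ H).symm x
      obtain ⟨z, hzS, hzr, hz⟩ := hSdense.exists_mem_lt_norm_sq_add (J := J) (A := A) (i := I u)
        (x := u) hr0 (hP0.trans_le (hp u)) (by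
          have ha := mul_le_mul_of_nonneg_left (hp u) hr0.le
          have hb := hq u
          have hc := hgi u
          have hd := sq_abs (J u)
          simp only [A]
          linarith)
      exact ⟨z, ⟨hzS, hzr⟩, hz⟩
  have hcrit : ∀ x : H, x + k (y, μ) x = 0 → x + gradient I x + μ • gradient J x = y := by
    intro x hx
    simp only [k] at hx
    rw [← sub_eq_zero, ← hx]
    abel
  obtain ⟨x₃, h₃₁, h₃₂, h₃⟩ := exists_third_critical_point (hK (y, μ)) (hk _) (hcoer _)
    (x₁ := (toWeakSpace ℝ H).symm x₁) (x₂ := (toWeakSpace ℝ H).symm x₂)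
    ((toWeakSpace ℝ H).symm.injective.ne hne)
    (fun w => h₁ (toWeakSpace ℝ H w)) (fun w => h₂ (toWeakSpace ℝ H w))
  exact ⟨y, μ, hzS, hzr, _, _, x₃, (toWeakSpace ℝ H).symm.injective.ne hne, h₃₁.symm, h₃₂.symm,
    hcrit _ ((hK (y, μ) _).half_norm_sq_add.eq_zero_of_forall_le fun w => h₁ (toWeakSpace ℝ H w)),
    hcrit _ ((hK (y, μ) _).half_norm_sq_add.eq_zero_of_forall_le fun w => h₂ (toWeakSpace ℝ H w)),
    hcrit _ h₃⟩
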